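/- Let $A$ be a finite alphabet. Formulas of \emph{weak unbounding logic} over $A$ are interpreted in infinite words $w\in A^{\omega}$, whose positions are the natural numbers. They are built from the atomic formulas $a(x)$ (the label of position $x$ is $a\in A$), $x=y$, $x<y$ and $x\in X$ by boolean connectives, first-order quantification over positions, quantification over \emph{finite} sets of positions, and the unbounding quantifier $$UX\,\varphi(X)\;=\;\bigwedge_{k\in\mathbb N}\exists X\,\bigl(\varphi(X)\wedge k\le |X|<\infty\bigr),$$ where $\varphi$ may have free variables besides $X$. Two formulas with the same free variables are equivalent if they are satisfied by the same infinite words under the same valuations, where a valuation assigns positions to the free first-order variables and arbitrary sets of positions to the free set variables. Then every formula of weak unbounding logic, with any free variables, is equivalent to a boolean combination, with the same free variables, of formulas of the form $UX\,\varphi(X)$, where $\varphi$ does not use the unbounding quantifier. -/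

import Mathlib

universe u

namespace WeakUnbounding

/-- Formulas of weak unbounding logic on infinite words over the alphabet `A`, with free first-order
variables indexed by `Fin m` and free set variables indexed by `Fin n`. A quantifier binds the
variable of index `0` in its body; the other variables are shifted by one. The remaining
connectives and universal quantifiers are the usual abbreviations. -/
inductive Formula (A : Type u) : ℕ → ℕ → Type u
  /-- the position `x` has label `a` -/
  | letter {m n : ℕ} (a : A) (x : Fin m) : Formula A m n
  /-- `x = y` -/
  | eq {m n : ℕ} (x y : Fin m) : Formula A m n
  /-- `x < y` -/
  | lt {m n : ℕ} (x y : Fin m) : Formula A m n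
  /-- `x ∈ X` -/
  | mem {m n : ℕ} (x : Fin m) (X : Fin n) : Formula A m n
  /-- negation -/
  | not {m n : ℕ} (φ : Formula A m n) : Formula A m n
  /-- conjunction -/
  | and {m n : ℕ} (φ ψ : Formula A m n) : Formula A m n
  /-- first-order quantification: there is a position `x` with `φ` -/
  | exPos {m n : ℕ} (φ : Formula A (m + 1) n) : Formula A m n
  /-- weak second-order quantification: there is a finite set `X` of positions with `φ` -/
  | exSet {m n : ℕ} (φ : Formula A m (n + 1)) : Formula A m n
  /-- the unbounding quantifier `U X. φ` -/
  | unb {m n : ℕ} (φ : Formula A m (n + 1)) : Formula A m n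

namespace Formula

/-- `φ.Holds w v V`: the infinite word `w` satisfies `φ` under the valuation sending the free
first-order variables to the positions `v` and the free set variables to the sets `V` of
positions. Free set variables may take arbitrary values; bound set variables range over the finite
sets of positions only. -/
def Holds {A : Type u} (w : ℕ → A) :
    {m n : ℕ} → Formula A m n → (Fin m → ℕ) → (Fin n → Set ℕ) → Prop
  | _, _, letter a x, v, _ => w (v x) = a
  | _, _, eq x y, v, _ => v x = v y
  | _, _, lt x y, v, _ => v x < v y
  | _, _, mem x X, v, V => v x ∈ V X
  | _, _, not φ, v, V => ¬ φ.Holds w v V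
  | _, _, and φ ψ, v, V => φ.Holds w v V ∧ ψ.Holds w v V
  | _, _, exPos φ, v, V => ∃ x : ℕ, φ.Holds w (Fin.cons (α := fun _ => ℕ) x v) V
  | _, _, exSet φ, v, V =>
      ∃ X : Finset ℕ, φ.Holds w v (Fin.cons (α := fun _ => Set ℕ) (X : Set ℕ) V)
  | _, _, unb φ, v, V =>
      ∀ k : ℕ, ∃ X : Finset ℕ,
        φ.Holds w v (Fin.cons (α := fun _ => Set ℕ) (X : Set ℕ) V) ∧ k ≤ X.card

/-- The formula does not use the unbounding quantifier. -/
def UFree {A : Type u} : {m n : ℕ} → Formula A m n → Prop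
  | _, _, letter _ _ => True
  | _, _, eq _ _ => True
  | _, _, lt _ _ => True
  | _, _, mem _ _ => True
  | _, _, not φ => φ.UFree
  | _, _, and φ ψ => φ.UFree ∧ ψ.UFree
  | _, _, exPos φ => φ.UFree
  | _, _, exSet φ => φ.UFree
  | _, _, unb _ => False

/-- Two formulas with the same free variables are equivalent: they are satisfied by the same words
and valuations. -/
def Equivalent {A : Type u} {m n : ℕ} (φ ψ : Formula A m n) : Prop :=
  ∀ (w : ℕ → A) (v : Fin m → ℕ) (V : Fin n → Set ℕ), φ.Holds w v V ↔ ψ.Holds w v V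

/-- Boolean combinations of the formulas in `S` (negation and conjunction generate all boolean
connectives). -/
inductive BoolComb {A : Type u} {m n : ℕ} (S : Set (Formula A m n)) : Formula A m n → Prop
  | basic (φ : Formula A m n) (h : φ ∈ S) : BoolComb S φ
  | not (φ : Formula A m n) (h : BoolComb S φ) : BoolComb S (Formula.not φ)
  | and (φ ψ : Formula A m n) (hφ : BoolComb S φ) (hψ : BoolComb S ψ) :
      BoolComb S (Formula.and φ ψ)

end Formula

end WeakUnbounding

/-! Boolean combinations of formulas UX θ, with θ free of U, are shown to be closed under all
quantifiers. The key is that such a combination ψ(X) separates finite sets X into boundedly many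
kinds, visibly to a U-free formula. Changing Y below a fixed j alters |Y| by at most j, so X and X'
agree on UY θ(X,Y) as soon as, for some j, every Y fitting one of them can be changed below j to fit
the other. This relation R is definable without U. Among enough finite sets two are R-related: take
j beyond all of them and apply the pigeonhole principle to the finitely many types of prefixes
(`exists_isTypeMap`).

R need not be transitive, so representatives Z_i are chosen greedily along the colexicographic
order, a definable well-order of the finite sets; boundedly many suffice. Then ∃X ψ(X) is the
disjunction of the ψ(Z_i), and UX ψ(X) is the disjunction of ψ(Z_i) ∧ UX (X R Z_i), because one of
finitely many pieces must be unbounded. As Z_i is definable, substituting it inside U keeps the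
required form. -/

namespace WeakUnbounding

open Formula

/-- Properties of a word together with a valuation. -/
abbrev Pred (A : Type u) (m n : ℕ) : Type u :=
  (ℕ → A) → (Fin m → ℕ) → (Fin n → Set ℕ) → Prop

/-- Extension of a valuation of the first-order variables. -/
abbrev consPos {m : ℕ} (x : ℕ) (v : Fin m → ℕ) : Fin (m + 1) → ℕ :=
  Fin.cons (α := fun _ => ℕ) x v

/-- Extension of a valuation of the set variables. -/
abbrev consSet {n : ℕ} (X : Set ℕ) (V : Fin n → Set ℕ) : Fin (n + 1) → Set ℕ :=
  Fin.cons (α := fun _ => Set ℕ) X V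

/-- The property is expressed by a formula without the unbounding quantifier. -/
def Definable {A : Type u} {m n : ℕ} (P : Pred A m n) : Prop :=
  ∃ φ : Formula A m n, φ.UFree ∧ ∀ w v V, φ.Holds w v V ↔ P w v V

/-! ### Renaming variables and closure of U-free definability -/

section Rename

variable {A : Type u}

theorem consPos_lift {m m' : ℕ} (σ : Fin m → Fin m') (x : ℕ) (v : Fin m' → ℕ) :
    (fun i => consPos x v (Fin.cons (α := fun _ => Fin (m' + 1)) 0 (fun i => (σ i).succ) i)) =
      consPos x (fun i => v (σ i)) := by
  funext i
  refine Fin.cases ?_ (fun i => ?_) i <;> simp [consPos]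

theorem consSet_lift {n n' : ℕ} (τ : Fin n → Fin n') (X : Set ℕ) (V : Fin n' → Set ℕ) :
    (fun i => consSet X V (Fin.cons (α := fun _ => Fin (n' + 1)) 0 (fun i => (τ i).succ) i)) =
      consSet X (fun i => V (τ i)) := by
  funext i
  refine Fin.cases ?_ (fun i => ?_) i <;> simp [consSet]

theorem Formula.exists_rename {m n : ℕ} (φ : Formula A m n) (hφ : φ.UFree) :
    ∀ {m' n' : ℕ} (σ : Fin m → Fin m') (τ : Fin n → Fin n'),
      ∃ ψ : Formula A m' n', ψ.UFree ∧
        ∀ w v V, ψ.Holds w v V ↔ φ.Holds w (fun i => v (σ i)) (fun i => V (τ i)) := by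
  induction φ with
  | letter a x => exact fun σ τ => ⟨.letter a (σ x), trivial, fun _ _ _ => Iff.rfl⟩
  | eq x y => exact fun σ τ => ⟨.eq (σ x) (σ y), trivial, fun _ _ _ => Iff.rfl⟩
  | lt x y => exact fun σ τ => ⟨.lt (σ x) (σ y), trivial, fun _ _ _ => Iff.rfl⟩
  | mem x X => exact fun σ τ => ⟨.mem (σ x) (τ X), trivial, fun _ _ _ => Iff.rfl⟩
  | not φ ih =>
    intro m' n' σ τ
    obtain ⟨ψ, h, hψ⟩ := ih hφ σ τ
    exact ⟨.not ψ, h, fun w v V => not_congr (hψ w v V)⟩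
  | and φ₁ φ₂ ih₁ ih₂ =>
    intro m' n' σ τ
    obtain ⟨ψ₁, h₁, hψ₁⟩ := ih₁ hφ.1 σ τ
    obtain ⟨ψ₂, h₂, hψ₂⟩ := ih₂ hφ.2 σ τ
    exact ⟨.and ψ₁ ψ₂, ⟨h₁, h₂⟩, fun w v V => and_congr (hψ₁ w v V) (hψ₂ w v V)⟩
  | exPos φ ih =>
    intro m' n' σ τ
    obtain ⟨ψ, h, hψ⟩ := ih hφ (Fin.cons 0 fun i => (σ i).succ) τ
    refine ⟨.exPos ψ, h, fun w v V => exists_congr fun x => ?_⟩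
    rw [hψ, consPos_lift]
  | exSet φ ih =>
    intro m' n' σ τ
    obtain ⟨ψ, h, hψ⟩ := ih hφ σ (Fin.cons 0 fun i => (τ i).succ)
    refine ⟨.exSet ψ, h, fun w v V => exists_congr fun x => ?_⟩
    rw [hψ, consSet_lift]
  | unb φ ih => exact hφ.elim

end Rename

namespace Definable

variable {A : Type u} {m n : ℕ} {P Q : Pred A m n}

theorem congr (hP : Definable P) (h : ∀ w v V, P w v V ↔ Q w v V) : Definable Q := by
  obtain ⟨φ, hφ, h'⟩ := hP
  exact ⟨φ, hφ, fun w v V => (h' w v V).trans (h w v V)⟩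

theorem eq (x y : Fin m) : Definable (fun _ v _ => v x = v y : Pred A m n) :=
  ⟨.eq x y, trivial, fun _ _ _ => Iff.rfl⟩

theorem lt (x y : Fin m) : Definable (fun _ v _ => v x < v y : Pred A m n) :=
  ⟨.lt x y, trivial, fun _ _ _ => Iff.rfl⟩

theorem mem (x : Fin m) (X : Fin n) : Definable (fun _ v V => v x ∈ V X : Pred A m n) :=
  ⟨.mem x X, trivial, fun _ _ _ => Iff.rfl⟩

theorem not (hP : Definable P) : Definable (fun w v V => ¬ P w v V) := by
  obtain ⟨φ, hφ, h⟩ := hP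
  exact ⟨.not φ, hφ, fun w v V => not_congr (h w v V)⟩

theorem and (hP : Definable P) (hQ : Definable Q) :
    Definable (fun w v V => P w v V ∧ Q w v V) := by
  obtain ⟨φ, hφ, h⟩ := hP
  obtain ⟨ψ, hψ, h'⟩ := hQ
  exact ⟨.and φ ψ, ⟨hφ, hψ⟩, fun w v V => and_congr (h w v V) (h' w v V)⟩

theorem or (hP : Definable P) (hQ : Definable Q) :
    Definable (fun w v V => P w v V ∨ Q w v V) :=
  (hP.not.and hQ.not).not.congr fun w v V => by tauto

theorem imp (hP : Definable P) (hQ : Definable Q) :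
    Definable (fun w v V => P w v V → Q w v V) :=
  (hP.and hQ.not).not.congr fun w v V => by tauto

theorem iff (hP : Definable P) (hQ : Definable Q) :
    Definable (fun w v V => P w v V ↔ Q w v V) :=
  ((hP.imp hQ).and (hQ.imp hP)).congr fun w v V => by tauto

theorem exPos {P : Pred A (m + 1) n} (hP : Definable P) :
    Definable (fun w v V => ∃ x, P w (consPos x v) V) := by
  obtain ⟨φ, hφ, h⟩ := hP
  exact ⟨.exPos φ, hφ, fun w v V => exists_congr fun x => h _ _ _⟩

theorem exSet {P : Pred A m (n + 1)} (hP : Definable P) :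
    Definable (fun w v V => ∃ X : Finset ℕ, P w v (consSet X V)) := by
  obtain ⟨φ, hφ, h⟩ := hP
  exact ⟨.exSet φ, hφ, fun w v V => exists_congr fun x => h _ _ _⟩

theorem allPos {P : Pred A (m + 1) n} (hP : Definable P) :
    Definable (fun w v V => ∀ x, P w (consPos x v) V) :=
  hP.not.exPos.not.congr fun w v V => by simp

theorem allSet {P : Pred A m (n + 1)} (hP : Definable P) :
    Definable (fun w v V => ∀ X : Finset ℕ, P w v (consSet X V)) :=
  hP.not.exSet.not.congr fun w v V => by simp

theorem rename (hP : Definable P) {m' n' : ℕ} (σ : Fin m → Fin m') (τ : Fin n → Fin n') :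
    Definable (fun w v V => P w (fun i => v (σ i)) (fun i => V (τ i))) := by
  obtain ⟨φ, hφ, h⟩ := hP
  obtain ⟨ψ, hψ, h'⟩ := φ.exists_rename hφ σ τ
  exact ⟨ψ, hψ, fun w v V => (h' w v V).trans (h _ _ _)⟩

theorem false : Definable (fun _ _ _ => False : Pred A m n) :=
  ((lt (A := A) (n := n) (0 : Fin (m + 1)) 0).exPos).congr fun w v V => by simp

end Definable

/-! ### Composition: finitely many types of prefixes -/

section FiniteIndex

variable {A : Type u} {m n : ℕ}

/-- The valuations agree as far as positions below `j` are concerned. -/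
def AgreeBelow (j : ℕ) (v v' : Fin m → ℕ) (V V' : Fin n → Set ℕ) : Prop :=
  (∀ x, v x = v' x ∨ j ≤ v x ∧ j ≤ v' x) ∧ ∀ i, ∀ y < j, y ∈ V i ↔ y ∈ V' i

/-- The valuations agree as far as positions from `j` onwards are concerned. -/
def AgreeAbove (j : ℕ) (v v' : Fin m → ℕ) (V V' : Fin n → Set ℕ) : Prop :=
  (∀ x, v x = v' x ∨ v x < j ∧ v' x < j) ∧ ∀ i, ∀ y, j ≤ y → (y ∈ V i ↔ y ∈ V' i)

theorem AgreeBelow.refl (j : ℕ) (v : Fin m → ℕ) (V : Fin n → Set ℕ) : AgreeBelow j v v V V :=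
  ⟨fun _ => Or.inl rfl, fun _ _ _ => Iff.rfl⟩

theorem AgreeAbove.refl (j : ℕ) (v : Fin m → ℕ) (V : Fin n → Set ℕ) : AgreeAbove j v v V V :=
  ⟨fun _ => Or.inl rfl, fun _ _ _ => Iff.rfl⟩

theorem AgreeAbove.symm {j : ℕ} {v v' : Fin m → ℕ} {V V' : Fin n → Set ℕ}
    (h : AgreeAbove j v v' V V') : AgreeAbove j v' v V' V :=
  ⟨fun x => (h.1 x).imp Eq.symm And.symm, fun i y hy => (h.2 i y hy).symm⟩

theorem AgreeBelow.consPos {j : ℕ} {v v' : Fin m → ℕ} {V V' : Fin n → Set ℕ} {x x' : ℕ}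
    (h : AgreeBelow j v v' V V') (hx : x = x' ∨ j ≤ x ∧ j ≤ x') :
    AgreeBelow j (consPos x v) (consPos x' v') V V' :=
  ⟨fun i => Fin.cases hx h.1 i, h.2⟩

theorem AgreeAbove.consPos {j : ℕ} {v v' : Fin m → ℕ} {V V' : Fin n → Set ℕ} {x x' : ℕ}
    (h : AgreeAbove j v v' V V') (hx : x = x' ∨ x < j ∧ x' < j) :
    AgreeAbove j (consPos x v) (consPos x' v') V V' :=
  ⟨fun i => Fin.cases hx h.1 i, h.2⟩

theorem AgreeBelow.consSet {j : ℕ} {v v' : Fin m → ℕ} {V V' : Fin n → Set ℕ} {X X' : Set ℕ}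
    (h : AgreeBelow j v v' V V') (hX : ∀ y < j, y ∈ X ↔ y ∈ X') :
    AgreeBelow j v v' (consSet X V) (consSet X' V') :=
  ⟨h.1, fun i => Fin.cases hX h.2 i⟩

theorem AgreeAbove.consSet {j : ℕ} {v v' : Fin m → ℕ} {V V' : Fin n → Set ℕ} {X X' : Set ℕ}
    (h : AgreeAbove j v v' V V') (hX : ∀ y, j ≤ y → (y ∈ X ↔ y ∈ X')) :
    AgreeAbove j v v' (consSet X V) (consSet X' V') :=
  ⟨h.1, fun i => Fin.cases hX h.2 i⟩

/-- `f` maps a valuation to a type, which is determined by its part below `j` and which, together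
with its part above `j`, determines whether `φ` holds. -/
structure IsTypeMap {K : Type} (φ : Formula A m n) (w : ℕ → A) (j : ℕ)
    (f : (Fin m → ℕ) → (Fin n → Set ℕ) → K) : Prop where
  below : ∀ v V v' V', AgreeBelow j v v' V V' → f v V = f v' V'
  above : ∀ v V v' V', AgreeAbove j v v' V V' → f v V = f v' V' →
    φ.Holds w v V → φ.Holds w v' V'

/-- The finite set coinciding with `X` below `j` and with `Y` above `j`. -/
def glue (j : ℕ) (X Y : Finset ℕ) : Finset ℕ :=
  X.filter (· < j) ∪ Y.filter (j ≤ ·)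

theorem mem_glue_below {j y : ℕ} {X Y : Finset ℕ} (h : y < j) : y ∈ glue j X Y ↔ y ∈ X := by
  simp [glue, h]

theorem mem_glue_above {j y : ℕ} {X Y : Finset ℕ} (h : j ≤ y) : y ∈ glue j X Y ↔ y ∈ Y := by
  simp [glue, h]

/-- If two valuations have the same types of extensions by a finite set, then a set can be
transferred from one to the other. -/
theorem IsTypeMap.exists_transfer {K : Type} {φ : Formula A m (n + 1)} {w : ℕ → A} {j : ℕ}
    {f : (Fin m → ℕ) → (Fin (n + 1) → Set ℕ) → K} (hf : IsTypeMap φ w j f)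
    {v v' : Fin m → ℕ} {V V' : Fin n → Set ℕ} (hV : AgreeAbove j v v' V V')
    (h : Set.range (fun X : Finset ℕ => f v (WeakUnbounding.consSet X V)) =
      Set.range (fun X : Finset ℕ => f v' (WeakUnbounding.consSet X V')))
    {X : Finset ℕ} (hX : φ.Holds w v (WeakUnbounding.consSet X V)) :
    ∃ X' : Finset ℕ, (∀ y, j ≤ y → (y ∈ X ↔ y ∈ X')) ∧
      φ.Holds w v' (WeakUnbounding.consSet X' V') := by
  obtain ⟨Z, hZ⟩ : f v (WeakUnbounding.consSet X V) ∈
      Set.range (fun X : Finset ℕ => f v' (WeakUnbounding.consSet X V')) := h ▸ ⟨X, rfl⟩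
  -- `Z` has the right type below `j`; above `j` the original `X` is kept.
  refine ⟨glue j Z X, fun y hy => (mem_glue_above hy).symm, ?_⟩
  refine hf.above _ _ _ _ (hV.consSet fun y hy => ?_) ?_ hX
  · simp [mem_glue_above hy]
  · refine hZ.symm.trans (hf.below _ _ _ _ ((AgreeBelow.refl j v' V').consSet fun y hy => ?_))
    simp [mem_glue_below hy]

theorem range_eq_of_agreeBelow {K : Type} {j : ℕ}
    {f : (Fin m → ℕ) → (Fin (n + 1) → Set ℕ) → K}
    (hf : ∀ v V v' V', AgreeBelow j v v' V V' → f v V = f v' V')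
    {v v' : Fin m → ℕ} {V V' : Fin n → Set ℕ} (h : AgreeBelow j v v' V V') :
    Set.range (fun X : Finset ℕ => f v (consSet X V)) =
      Set.range (fun X : Finset ℕ => f v' (consSet X V')) :=
  congrArg Set.range (funext fun _ => hf _ _ _ _ (h.consSet fun _ _ => Iff.rfl))

/-- Induction on `φ`: the type of a quantified formula records which types of the body are realised
by witnesses. `K` depends on `φ` alone, which later makes the number of representatives uniform. -/
theorem exists_isTypeMap (φ : Formula A m n) (hφ : φ.UFree) :
    ∃ K : Type, Finite K ∧ ∀ (w : ℕ → A) (j : ℕ),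
      ∃ f : (Fin m → ℕ) → (Fin n → Set ℕ) → K, IsTypeMap φ w j f := by
  induction φ with
  | letter a x =>
    refine ⟨Prop, inferInstance, fun w j => ⟨fun v _ => v x < j ∧ w (v x) = a, ?_, ?_⟩⟩
    · intro v V v' V' h
      rcases h.1 x with h | h
      · simp only [h]
      · simp [not_lt.2 h.1, not_lt.2 h.2]
    · intro v V v' V' h e hv
      simp only [Holds] at hv ⊢
      rcases h.1 x with h | h
      · rwa [← h]
      · exact (e.mp ⟨h.1, hv⟩).2
  | eq x y =>
    refine ⟨Prop, inferInstance, fun w j => ⟨fun v _ => v x < j ∧ v y < j ∧ v x = v y, ?_, ?_⟩⟩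
    · intro v V v' V' h
      have h1 := h.1 x
      have h2 := h.1 y
      simp only [eq_iff_iff]
      omega
    · intro v V v' V' h e hv
      simp only [Holds, eq_iff_iff] at hv e ⊢
      have h1 := h.1 x
      have h2 := h.1 y
      omega
  | lt x y =>
    refine ⟨Prop, inferInstance, fun w j => ⟨fun v _ => v x < j ∧ v y < j ∧ v x < v y, ?_, ?_⟩⟩
    · intro v V v' V' h
      have h1 := h.1 x
      have h2 := h.1 y
      simp only [eq_iff_iff]
      omega
    · intro v V v' V' h e hv
      simp only [Holds, eq_iff_iff] at hv e ⊢
      have h1 := h.1 x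
      have h2 := h.1 y
      omega
  | mem x X =>
    refine ⟨Prop, inferInstance, fun w j => ⟨fun v V => v x < j ∧ v x ∈ V X, ?_, ?_⟩⟩
    · intro v V v' V' h
      rcases h.1 x with hx | hx
      · rw [eq_iff_iff, hx]
        exact and_congr_right fun hj => h.2 X _ hj
      · simp [not_lt.2 hx.1, not_lt.2 hx.2]
    · intro v V v' V' h e hv
      simp only [Holds] at hv ⊢
      by_cases hj : v x < j
      · exact (e.mp ⟨hj, hv⟩).2
      · have hx : v x = v' x := (h.1 x).resolve_right fun h => hj h.1
        rw [← hx]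
        exact (h.2 X _ (not_lt.1 hj)).1 hv
  | not φ ih =>
    obtain ⟨K, hK, h⟩ := ih hφ
    refine ⟨K, hK, fun w j => ?_⟩
    obtain ⟨f, hf⟩ := h w j
    exact ⟨f, hf.below, fun v V v' V' h e hv hv' => hv (hf.above _ _ _ _ h.symm e.symm hv')⟩
  | and φ ψ ih₁ ih₂ =>
    obtain ⟨K₁, _, h₁⟩ := ih₁ hφ.1
    obtain ⟨K₂, _, h₂⟩ := ih₂ hφ.2
    refine ⟨K₁ × K₂, inferInstance, fun w j => ?_⟩
    obtain ⟨f₁, hf₁⟩ := h₁ w j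
    obtain ⟨f₂, hf₂⟩ := h₂ w j
    refine ⟨fun v V => (f₁ v V, f₂ v V), fun v V v' V' h => ?_, fun v V v' V' h e hv => ?_⟩
    · exact Prod.ext (hf₁.below _ _ _ _ h) (hf₂.below _ _ _ _ h)
    · exact ⟨hf₁.above _ _ _ _ h (congrArg Prod.fst e) hv.1,
        hf₂.above _ _ _ _ h (congrArg Prod.snd e) hv.2⟩
  | exPos φ ih =>
    obtain ⟨K, _, h⟩ := ih hφ
    refine ⟨Set K × K, inferInstance, fun w j => ?_⟩
    obtain ⟨f, hf⟩ := h w j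
    -- All witnesses from `j` onwards look alike from below `j`, so `j` itself stands for them.
    refine ⟨fun v V => ((fun x => f (consPos x v) V) '' Set.Iio j, f (consPos j v) V),
      fun v V v' V' h => ?_, fun v V v' V' h e => ?_⟩
    · have key : ∀ x, f (consPos x v) V = f (consPos x v') V' := fun x =>
        hf.below _ _ _ _ (h.consPos (Or.inl rfl))
      simp only [key]
    · rintro ⟨x, hx⟩
      rw [Prod.mk.injEq] at e
      by_cases hj : x < j
      · obtain ⟨x', hx', hf'⟩ : f (consPos x v) V ∈ (fun x => f (consPos x v') V') '' Set.Iio j :=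
          e.1 ▸ ⟨x, hj, rfl⟩
        exact ⟨x', hf.above _ _ _ _ (h.consPos (Or.inr ⟨hj, hx'⟩)) hf'.symm hx⟩
      · have key : ∀ (v : Fin _ → ℕ) (V : Fin _ → Set ℕ),
            f (consPos x v) V = f (consPos j v) V := fun v V =>
          hf.below _ _ _ _ ((AgreeBelow.refl j v V).consPos (Or.inr ⟨not_lt.1 hj, le_rfl⟩))
        exact ⟨x, hf.above _ _ _ _ (h.consPos (Or.inl rfl)) (by rw [key, key, e.2]) hx⟩
  | exSet φ ih =>
    obtain ⟨K, _, h⟩ := ih hφ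
    refine ⟨Set K, inferInstance, fun w j => ?_⟩
    obtain ⟨f, hf⟩ := h w j
    refine ⟨fun v V => Set.range fun X : Finset ℕ => f v (consSet X V),
      fun v V v' V' h => range_eq_of_agreeBelow hf.below h, fun v V v' V' h e => ?_⟩
    rintro ⟨X, hX⟩
    obtain ⟨X', -, hX'⟩ := hf.exists_transfer h e hX
    exact ⟨X', hX'⟩
  | unb φ ih => exact hφ.elim

end FiniteIndex

namespace Definable

variable {A : Type u} {m n : ℕ}

theorem rename_one {P : Pred A m (n + 1)} (hP : Definable P) {m' n' : ℕ} (σ : Fin m → Fin m')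
    (a : Fin n') (τ : Fin n → Fin n') :
    Definable (fun w v V =>
      P w (fun i => v (σ i)) (consSet (V a) fun i => V (τ i)) : Pred A m' n') := by
  refine (hP.rename σ (Fin.cons (α := fun _ => Fin n') a τ)).congr fun w v V => ?_
  rw [show (fun i => V (Fin.cons (α := fun _ => Fin n') a τ i)) =
    consSet (V a) (fun i => V (τ i)) from funext (Fin.cases rfl fun i => rfl)]

theorem rename_two {P : Pred A m (n + 1 + 1)} (hP : Definable P) {m' n' : ℕ}
    (σ : Fin m → Fin m') (a b : Fin n') (τ : Fin n → Fin n') :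
    Definable (fun w v V =>
      P w (fun i => v (σ i)) (consSet (V a) (consSet (V b) fun i => V (τ i))) :
        Pred A m' n') := by
  refine (hP.rename_one σ a (Fin.cons (α := fun _ => Fin n') b τ)).congr fun w v V => ?_
  rw [show (fun i => V (Fin.cons (α := fun _ => Fin n') b τ i)) =
    consSet (V b) (fun i => V (τ i)) from funext (Fin.cases rfl fun i => rfl)]

end Definable

/-! ### Definable relations that preserve boolean combinations of U-formulas -/

section Control

variable {A : Type u} {m n : ℕ}

/-- The formulas `U X. θ` where `θ` does not use the unbounding quantifier. -/
abbrev unbFormulas (A : Type u) (m n : ℕ) : Set (Formula A m n) :=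
  {χ | ∃ θ : Formula A m (n + 1), θ.UFree ∧ χ = Formula.unb θ}

/-- A family of symmetric relations on finite sets, indexed by `j`, which are definable, respect the
property `P` of the set variable of index `0`, and contain the kernel of a map from the subsets of
`{0, …, j - 1}` to a finite type that does not depend on `j`, the word and the valuation. -/
structure IsControl (P : Pred A m (n + 1))
    (E : (ℕ → A) → (Fin m → ℕ) → (Fin n → Set ℕ) → ℕ → Set ℕ → Set ℕ → Prop) : Prop where
  definable : Definable (fun w v V =>
    E w (fun i => v i.succ) (fun i => V i.succ.succ) (v 0) (V 0) (V 1) : Pred A (m + 1) (n + 2))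
  symm : ∀ w v V j (X Y : Finset ℕ), E w v V j X Y → E w v V j Y X
  invariant : ∀ w v V j (X Y : Finset ℕ), E w v V j X Y →
    (P w v (consSet X V) ↔ P w v (consSet Y V))
  finite : ∃ K : Type, Finite K ∧ ∀ w v V j, ∃ g : Finset ℕ → K, ∀ X Y : Finset ℕ,
    (∀ y ∈ X, y < j) → (∀ y ∈ Y, y < j) → g X = g Y → E w v V j X Y

/-- Every finite set that satisfies `θ` together with `X` can be changed below `j` so as to satisfy
`θ` together with `X'`. -/
def Simulates (θ : Formula A m (n + 1 + 1)) (w : ℕ → A) (v : Fin m → ℕ) (V : Fin n → Set ℕ)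
    (j : ℕ) (X X' : Set ℕ) : Prop :=
  ∀ Y : Finset ℕ, θ.Holds w v (consSet Y (consSet X V)) →
    ∃ Y' : Finset ℕ, (∀ y, j ≤ y → (y ∈ Y ↔ y ∈ Y')) ∧
      θ.Holds w v (consSet Y' (consSet X' V))

theorem definable_simulates {θ : Formula A m (n + 1 + 1)} (hθ : θ.UFree) :
    Definable (fun w v V =>
      Simulates θ w (fun i => v i.succ) (fun i => V i.succ.succ) (v 0) (V 0) (V 1) :
        Pred A (m + 1) (n + 2)) := by
  have h : Definable θ.Holds := ⟨θ, hθ, fun _ _ _ => Iff.rfl⟩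
  have h₁ : Definable (A := A) (m := m + 1) (n := n + 4)
      (fun _ v V => ∀ y, ¬ y < v 0 → (y ∈ V 1 ↔ y ∈ V 0)) :=
    (((Definable.lt 0 1).not).imp ((Definable.mem 0 1).iff (Definable.mem 0 0))).allPos
  refine ((h.rename_two Fin.succ 0 1 fun i => i.succ.succ.succ).imp
    (h₁.and (h.rename_two Fin.succ 0 3 fun i => i.succ.succ.succ.succ)).exSet).allSet.congr
    fun w v V => ?_
  simp only [not_lt]
  rfl

theorem Simulates.symmetrization_definable {θ : Formula A m (n + 1 + 1)} (hθ : θ.UFree) :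
    Definable (fun w v V =>
      Simulates θ w (fun i => v i.succ) (fun i => V i.succ.succ) (v 0) (V 0) (V 1) ∧
      Simulates θ w (fun i => v i.succ) (fun i => V i.succ.succ) (v 0) (V 1) (V 0) :
        Pred A (m + 1) (n + 2)) :=
  (definable_simulates hθ).and
    ((definable_simulates hθ).rename id
      -- This renaming swaps the two compared sets.
      (Fin.cons 1 (Fin.cons 0 fun i => i.succ.succ)))

theorem Simulates.unb {θ : Formula A m (n + 1 + 1)} {w : ℕ → A} {v : Fin m → ℕ}
    {V : Fin n → Set ℕ} {j : ℕ} {X Y : Set ℕ} (h : Simulates θ w v V j X Y)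
    (hX : (Formula.unb θ).Holds w v (consSet X V)) :
    (Formula.unb θ).Holds w v (consSet Y V) := by
  intro k
  -- The surplus `j` pays for the elements below `j` that the transfer may delete.
  obtain ⟨S, hS, hc⟩ := hX (k + j)
  obtain ⟨T, hT, hT'⟩ := h S hS
  refine ⟨T, hT', ?_⟩
  have hsub : S ⊆ Finset.range j ∪ T := by
    intro y hy
    rcases lt_or_ge y j with hj | hj
    · exact Finset.mem_union_left _ (Finset.mem_range.2 hj)
    · exact Finset.mem_union_right _ ((hT y hj).1 hy)
  have := (Finset.card_le_card hsub).trans (Finset.card_union_le _ _)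
  rw [Finset.card_range] at this
  omega

theorem isControl_unb {θ : Formula A m (n + 1 + 1)} (hθ : θ.UFree) :
    IsControl (Formula.unb θ).Holds fun w v V j X Y =>
      Simulates θ w v V j X Y ∧ Simulates θ w v V j Y X where
  definable := Simulates.symmetrization_definable hθ
  symm _ _ _ _ _ _ h := h.symm
  invariant _ _ _ _ _ _ h := ⟨h.1.unb, h.2.unb⟩
  finite := by
    obtain ⟨K, _, h⟩ := exists_isTypeMap θ hθ
    refine ⟨Set K, inferInstance, fun w v V j => ?_⟩
    obtain ⟨f, hf⟩ := h w j
    refine ⟨fun X => Set.range fun Y : Finset ℕ => f v (consSet Y (consSet X V)),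
      fun X Y hX hY e => ?_⟩
    -- Both sets lie below `j`, so above it the two valuations coincide.
    have key : AgreeAbove j v v (consSet X V) (consSet Y V) :=
      (AgreeAbove.refl j v V).consSet fun y hy =>
        iff_of_false (fun h => (hX y h).not_ge hy) fun h => (hY y h).not_ge hy
    exact ⟨fun S hS => hf.exists_transfer key e hS,
      fun S hS => hf.exists_transfer key.symm e.symm hS⟩

theorem exists_isControl {ψ : Formula A m (n + 1)}
    (hψ : BoolComb (unbFormulas A m (n + 1)) ψ) : ∃ E, IsControl ψ.Holds E := by
  induction hψ with
  | basic φ h =>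
    obtain ⟨θ, hθ, rfl⟩ := h
    exact ⟨_, isControl_unb hθ⟩
  | not φ _ ih =>
    obtain ⟨E, h⟩ := ih
    exact ⟨E, { h with invariant := fun w v V j X Y e => not_congr (h.invariant w v V j X Y e) }⟩
  | and φ₁ φ₂ _ _ ih₁ ih₂ =>
    obtain ⟨E₁, h₁⟩ := ih₁
    obtain ⟨E₂, h₂⟩ := ih₂
    refine ⟨fun w v V j X Y => E₁ w v V j X Y ∧ E₂ w v V j X Y, ?_⟩
    refine ⟨h₁.definable.and h₂.definable,
      fun w v V j X Y e => ⟨h₁.symm _ _ _ _ _ _ e.1, h₂.symm _ _ _ _ _ _ e.2⟩,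
      fun w v V j X Y e =>
        and_congr (h₁.invariant _ _ _ _ _ _ e.1) (h₂.invariant _ _ _ _ _ _ e.2), ?_⟩
    obtain ⟨K₁, _, hK₁⟩ := h₁.finite
    obtain ⟨K₂, _, hK₂⟩ := h₂.finite
    refine ⟨K₁ × K₂, inferInstance, fun w v V j => ?_⟩
    obtain ⟨g₁, hg₁⟩ := hK₁ w v V j
    obtain ⟨g₂, hg₂⟩ := hK₂ w v V j
    exact ⟨fun X => (g₁ X, g₂ X), fun X Y hX hY e =>
      ⟨hg₁ X Y hX hY (congrArg Prod.fst e), hg₂ X Y hX hY (congrArg Prod.snd e)⟩⟩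

end Control

/-! ### Greedy choice of representatives in colexicographic order -/

section Representatives

/-- The colexicographic order: the largest element in which `S` and `T` differ is in `T`. -/
def ColexLT (S T : Set ℕ) : Prop :=
  ∃ a ∈ T, a ∉ S ∧ ∀ b ∈ S, b ∉ T → b < a

/-- Finite sets are compared as the natural numbers whose binary digits they encode; linearity and
well-foundedness follow. -/
theorem colexLT_iff {S T : Finset ℕ} :
    ColexLT S T ↔ Finset.orderIsoColex.symm (toColex S) < Finset.orderIsoColex.symm (toColex T) := by
  rw [OrderIso.lt_iff_lt, Finset.Colex.toColex_lt_toColex_iff_exists_forall_lt]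
  rfl

theorem ColexLT.trichotomy (S T : Finset ℕ) : ColexLT S T ∨ S = T ∨ ColexLT T S := by
  rw [colexLT_iff, colexLT_iff]
  rcases lt_trichotomy (Finset.orderIsoColex.symm (toColex S))
    (Finset.orderIsoColex.symm (toColex T)) with h | h | h
  · exact Or.inl h
  · exact Or.inr (Or.inl (toColex.injective (Finset.orderIsoColex.symm.injective h)))
  · exact Or.inr (Or.inr h)

theorem ColexLT.wellFounded : WellFounded fun S T : Finset ℕ => ColexLT S T := by
  have : (fun S T : Finset ℕ => ColexLT S T) =
      InvImage (· < ·) fun S : Finset ℕ => Finset.orderIsoColex.symm (toColex S) := by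
    funext S T
    exact propext colexLT_iff
  rw [this]
  exact InvImage.wf _ wellFounded_lt

/-- The set is related to one of the first `i` representatives, where the next representative is
always the least finite set that is not related to the earlier ones. -/
def Covered (R : Set ℕ → Set ℕ → Prop) : ℕ → Set ℕ → Prop
  | 0, _ => False
  | i + 1, X => Covered R i X ∨ ∃ Z : Finset ℕ,
      (¬ Covered R i Z ∧ ∀ Y : Finset ℕ, ColexLT Y Z → Covered R i Y) ∧ R X Z

/-- The set is the representative number `i` for the relation `R`. -/
def IsRep (R : Set ℕ → Set ℕ → Prop) (i : ℕ) (X : Set ℕ) : Prop :=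
  ¬ Covered R i X ∧ ∀ Y : Finset ℕ, ColexLT Y X → Covered R i Y

variable {R : Set ℕ → Set ℕ → Prop}

theorem Covered.mono {i j : ℕ} (h : i ≤ j) {X : Set ℕ} (hX : Covered R i X) : Covered R j X := by
  induction h with
  | refl => exact hX
  | step _ ih => exact Or.inl ih

theorem Covered.exists_isRep {i : ℕ} {X : Set ℕ} (h : Covered R i X) :
    ∃ k < i, ∃ Z : Finset ℕ, IsRep R k Z ∧ R X Z := by
  induction i with
  | zero => exact h.elim
  | succ i ih =>
    rcases h with h | ⟨Z, hZ, hR⟩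
    · obtain ⟨k, hk, h⟩ := ih h
      exact ⟨k, hk.trans (Nat.lt_succ_self i), h⟩
    · exact ⟨i, Nat.lt_succ_self i, Z, hZ, hR⟩

theorem IsRep.unique {i : ℕ} {X Y : Finset ℕ} (hX : IsRep R i X) (hY : IsRep R i Y) : X = Y := by
  rcases ColexLT.trichotomy X Y with h | h | h
  · exact (hX.1 (hY.2 X h)).elim
  · exact h
  · exact (hY.1 (hX.2 Y h)).elim

theorem exists_isRep {i : ℕ} {X : Finset ℕ} (h : ¬ Covered R i X) :
    ∃ Z : Finset ℕ, IsRep R i Z := by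
  obtain ⟨Z, hZ, hmin⟩ :=
    ColexLT.wellFounded.has_min {Z : Finset ℕ | ¬ Covered R i Z} ⟨X, h⟩
  exact ⟨Z, hZ, fun Y hY => by_contra fun h' => hmin Y h' hY⟩

theorem IsRep.not_rel {i k : ℕ} (h : i < k) {X Y : Finset ℕ} (hX : IsRep R i X)
    (hY : IsRep R k Y) : ¬ R Y X := fun hR =>
  hY.1 (Covered.mono (Nat.succ_le_of_lt h) (Or.inr ⟨X, hX, hR⟩))

/-- A set still uncovered at stage `N` would yield representatives at stages 0 to `N`, and these are
pairwise unrelated. Transitivity of `R` plays no role. -/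
theorem covered_of_finite_index (hsymm : ∀ X Y : Finset ℕ, R X Y → R Y X) {N : ℕ}
    (hN : ∀ s : Fin (N + 1) → Finset ℕ, ∃ a b, a ≠ b ∧ R (s a) (s b)) (X : Finset ℕ) :
    Covered R N X := by
  by_contra hX
  have h : ∀ a : Fin (N + 1), ∃ Z : Finset ℕ, IsRep R a Z := fun a =>
    exists_isRep fun h => hX (h.mono (Nat.lt_succ_iff.1 a.2))
  choose s hs using h
  obtain ⟨a, b, hab, hR⟩ := hN s
  rcases lt_or_gt_of_ne hab with h | h
  · exact (hs a).not_rel h (hs b) (hsymm _ _ hR)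
  · exact (hs b).not_rel h (hs a) hR

variable {A : Type u} {m n : ℕ}

theorem definable_colexLT (a b : Fin n) :
    Definable (fun _ _ V => ColexLT (V a) (V b) : Pred A m n) := by
  have h : Definable (A := A) (m := m + 1) (n := n)
      (fun _ v V => ∀ y, y ∈ V a → y ∉ V b → y < v 0) :=
    ((Definable.mem 0 a).imp ((Definable.mem 0 b).not.imp (Definable.lt 0 1))).allPos
  exact ((Definable.mem 0 b).and ((Definable.mem 0 a).not.and h)).exPos

theorem definable_isRep_of_covered
    {R : (ℕ → A) → (Fin m → ℕ) → (Fin n → Set ℕ) → Set ℕ → Set ℕ → Prop} {i : ℕ}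
    (h : Definable (fun w v V => Covered (R w v fun i => V i.succ) i (V 0) : Pred A m (n + 1))) :
    Definable (fun w v V => IsRep (R w v fun i => V i.succ) i (V 0) : Pred A m (n + 1)) := by
  have h' : Definable (A := A) (m := m) (n := n + 2) (fun w v V =>
      Covered (R w v fun i => V i.succ.succ) i (V 0)) :=
    h.rename id (Fin.cons 0 fun i => i.succ.succ)
  exact h.not.and ((definable_colexLT 0 1).imp h').allSet

theorem definable_covered
    {R : (ℕ → A) → (Fin m → ℕ) → (Fin n → Set ℕ) → Set ℕ → Set ℕ → Prop}
    (hR : Definable (fun w v V =>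
      R w v (fun i => V i.succ.succ) (V 0) (V 1) : Pred A m (n + 2))) (i : ℕ) :
    Definable (fun w v V => Covered (R w v fun i => V i.succ) i (V 0) : Pred A m (n + 1)) := by
  induction i with
  | zero => exact Definable.false
  | succ i ih =>
    have h₁ : Definable (A := A) (m := m) (n := n + 2) (fun w v V =>
        IsRep (R w v fun i => V i.succ.succ) i (V 0)) :=
      (definable_isRep_of_covered ih).rename id (Fin.cons 0 fun i => i.succ.succ)
    have h₂ : Definable (A := A) (m := m) (n := n + 2) (fun w v V =>
        R w v (fun i => V i.succ.succ) (V 1) (V 0)) :=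
      hR.rename id (Fin.cons 1 (Fin.cons 0 fun i => i.succ.succ))
    exact ih.or (h₁.and h₂).exSet

end Representatives

/-! ### Closure of the normal form under quantifiers -/

section Expressible

variable {A : Type u} {m n : ℕ}

/-- The property is expressed by a boolean combination of formulas `U X. θ` where `θ` does not use
the unbounding quantifier. -/
def Expressible (P : Pred A m n) : Prop :=
  ∃ ψ : Formula A m n, BoolComb (unbFormulas A m n) ψ ∧ ∀ w v V, ψ.Holds w v V ↔ P w v V

namespace Expressible

variable {P Q : Pred A m n}

theorem congr (hP : Expressible P) (h : ∀ w v V, P w v V ↔ Q w v V) : Expressible Q := by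
  obtain ⟨φ, hφ, h'⟩ := hP
  exact ⟨φ, hφ, fun w v V => (h' w v V).trans (h w v V)⟩

theorem not (hP : Expressible P) : Expressible (fun w v V => ¬ P w v V) := by
  obtain ⟨φ, hφ, h⟩ := hP
  exact ⟨.not φ, hφ.not, fun w v V => not_congr (h w v V)⟩

theorem and (hP : Expressible P) (hQ : Expressible Q) :
    Expressible (fun w v V => P w v V ∧ Q w v V) := by
  obtain ⟨φ, hφ, h⟩ := hP
  obtain ⟨ψ, hψ, h'⟩ := hQ
  exact ⟨.and φ ψ, hφ.and _ _ hψ, fun w v V => and_congr (h w v V) (h' w v V)⟩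

theorem or (hP : Expressible P) (hQ : Expressible Q) :
    Expressible (fun w v V => P w v V ∨ Q w v V) :=
  (hP.not.and hQ.not).not.congr fun w v V => by tauto

theorem unb {P : Pred A m (n + 1)} (hP : Definable P) :
    Expressible (fun w v V => ∀ k : ℕ, ∃ X : Finset ℕ, P w v (consSet X V) ∧ k ≤ X.card) := by
  obtain ⟨φ, hφ, h⟩ := hP
  exact ⟨.unb φ, .basic _ ⟨φ, hφ, rfl⟩, fun w v V => forall_congr' fun k =>
    exists_congr fun X => and_congr_left fun _ => h _ _ _⟩

end Expressible

/-- A U-free property is put under U with a dummy set variable: arbitrarily large finite sets always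
exist. -/
theorem Definable.expressible {P : Pred A m n} (hP : Definable P) : Expressible P := by
  refine (Expressible.unb (hP.rename id Fin.succ)).congr fun w v V => ?_
  exact ⟨fun h => (h 0).choose_spec.1, fun h k => ⟨Finset.range k, h, by simp⟩⟩

theorem Expressible.exists_lt {P : ℕ → Pred A m n} (h : ∀ i, Expressible (P i)) (N : ℕ) :
    Expressible (fun w v V => ∃ i < N, P i w v V) := by
  induction N with
  | zero => exact Definable.false.expressible.congr fun w v V => by simp
  | succ N ih =>
    refine (ih.or (h N)).congr fun w v V => ?_
    simp only [Nat.lt_succ_iff_lt_or_eq, or_and_right, exists_or, exists_eq_left]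

/-- A definable finite set can be substituted for a set variable. -/
theorem Expressible.subst {P : Pred A m (n + 1)} (hP : Expressible P)
    {D : (ℕ → A) → (Fin m → ℕ) → (Fin n → Set ℕ) → Set ℕ → Prop}
    (hD : Definable (fun w v V => D w v (fun i => V i.succ) (V 0) : Pred A m (n + 1))) :
    ∃ Q : Pred A m n, Expressible Q ∧ ∀ w v V (X : Finset ℕ), D w v V X →
      (∀ X' : Finset ℕ, D w v V X' → X' = X) → (Q w v V ↔ P w v (consSet X V)) := by
  obtain ⟨ψ, hψ, h⟩ := hP
  suffices H : ∃ Q : Pred A m n, Expressible Q ∧ ∀ w v V (X : Finset ℕ), D w v V X →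
      (∀ X' : Finset ℕ, D w v V X' → X' = X) → (Q w v V ↔ ψ.Holds w v (consSet X V)) by
    obtain ⟨Q, hQ, hQ'⟩ := H
    exact ⟨Q, hQ, fun w v V X hX hX' => (hQ' w v V X hX hX').trans (h _ _ _)⟩
  clear h
  induction hψ with
  | basic φ h =>
    obtain ⟨θ, hθ, rfl⟩ := h
    have hθ' : Definable θ.Holds := ⟨θ, hθ, fun _ _ _ => Iff.rfl⟩
    have h₁ : Definable (A := A) (m := m) (n := n + 2) (fun w v V =>
        D w v (fun i => V i.succ.succ) (V 0)) := hD.rename id (Fin.cons 0 fun i => i.succ.succ)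
    -- The substituted set is quantified inside U; its uniqueness makes it the same for every `k`.
    refine ⟨_, Expressible.unb
      (h₁.and (hθ'.rename_two id 1 0 fun i => i.succ.succ)).exSet, fun w v V X hX hX' => ?_⟩
    refine forall_congr' fun k => exists_congr fun Y => and_congr_left fun _ => ?_
    constructor
    · rintro ⟨Z, hZ, h⟩
      obtain rfl := hX' Z hZ
      exact h
    · exact fun h => ⟨X, hX, h⟩
  | not φ _ ih =>
    obtain ⟨Q, hQ, h⟩ := ih
    exact ⟨_, hQ.not, fun w v V X hX hX' => not_congr (h w v V X hX hX')⟩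
  | and φ₁ φ₂ _ _ ih₁ ih₂ =>
    obtain ⟨Q₁, hQ₁, h₁⟩ := ih₁
    obtain ⟨Q₂, hQ₂, h₂⟩ := ih₂
    exact ⟨_, hQ₁.and hQ₂, fun w v V X hX hX' =>
      and_congr (h₁ w v V X hX hX') (h₂ w v V X hX hX')⟩

/-- A first-order variable can be replaced by a set variable ranging over singletons. -/
theorem Expressible.singleton {P : Pred A (m + 1) n} (hP : Expressible P) :
    ∃ Q : Pred A m (n + 1), Expressible Q ∧ ∀ w v V (x : ℕ),
      Q w v (consSet {x} V) ↔ P w (consPos x v) V := by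
  obtain ⟨ψ, hψ, h⟩ := hP
  suffices H : ∃ Q : Pred A m (n + 1), Expressible Q ∧ ∀ w v V (x : ℕ),
      Q w v (consSet {x} V) ↔ ψ.Holds w (consPos x v) V by
    obtain ⟨Q, hQ, hQ'⟩ := H
    exact ⟨Q, hQ, fun w v V x => (hQ' w v V x).trans (h _ _ _)⟩
  clear h
  induction hψ with
  | basic φ h =>
    obtain ⟨θ, hθ, rfl⟩ := h
    have hθ' : Definable θ.Holds := ⟨θ, hθ, fun _ _ _ => Iff.rfl⟩
    refine ⟨_, Expressible.unb (((Definable.mem 0 1).and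
      (hθ'.rename_one id 0 fun i => i.succ.succ)).exPos), fun w v V x => ?_⟩
    refine forall_congr' fun k => exists_congr fun Y => and_congr_left fun _ => ?_
    constructor
    · rintro ⟨y, hy, h⟩
      obtain rfl : y = x := hy
      exact h
    · exact fun h => ⟨x, rfl, h⟩
  | not φ _ ih =>
    obtain ⟨Q, hQ, h⟩ := ih
    exact ⟨_, hQ.not, fun w v V x => not_congr (h w v V x)⟩
  | and φ₁ φ₂ _ _ ih₁ ih₂ =>
    obtain ⟨Q₁, hQ₁, h₁⟩ := ih₁
    obtain ⟨Q₂, hQ₂, h₂⟩ := ih₂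
    exact ⟨_, hQ₁.and hQ₂, fun w v V x => and_congr (h₁ w v V x) (h₂ w v V x)⟩

/-- For an expressible property `P` there is a definable relation respecting `P` such that every
finite set is related to one of boundedly many representatives. -/
theorem Expressible.exists_relation {P : Pred A m (n + 1)} (hP : Expressible P) :
    ∃ (R : (ℕ → A) → (Fin m → ℕ) → (Fin n → Set ℕ) → Set ℕ → Set ℕ → Prop) (N : ℕ),
      Definable (fun w v V =>
        R w v (fun i => V i.succ.succ) (V 0) (V 1) : Pred A m (n + 2)) ∧
      ∀ w v V,
        (∀ X Y : Finset ℕ, R w v V X Y → (P w v (consSet X V) ↔ P w v (consSet Y V))) ∧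
        ∀ X : Finset ℕ, Covered (R w v V) N X := by
  obtain ⟨ψ, hψ, h⟩ := hP
  obtain ⟨E, hE⟩ := exists_isControl hψ
  obtain ⟨K, _, hK⟩ := hE.finite
  -- Quantifying `j` away lets one relation compare finite sets of any extent; `Nat.card K` is the
  -- pigeonhole bound.
  refine ⟨fun w v V X Y => ∃ j, E w v V j X Y, Nat.card K, hE.definable.exPos,
    fun w v V => ⟨?_, ?_⟩⟩
  · rintro X Y ⟨j, hj⟩
    rw [← h, ← h]
    exact hE.invariant w v V j X Y hj
  · refine covered_of_finite_index (fun X Y ⟨j, hj⟩ => ⟨j, hE.symm w v V j X Y hj⟩) fun s => ?_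
    obtain ⟨j, hj⟩ : ∃ j, ∀ a, ∀ y ∈ s a, y < j := by
      refine ⟨(Finset.univ.biUnion s).sup id + 1, fun a y hy => Nat.lt_succ_of_le ?_⟩
      exact Finset.le_sup (f := id) (Finset.mem_biUnion.2 ⟨a, Finset.mem_univ a, hy⟩)
    obtain ⟨g, hg⟩ := hK w v V j
    obtain ⟨a, b, hab, he⟩ : ∃ a b, a ≠ b ∧ g (s a) = g (s b) := by
      by_contra! hne
      have hinj : Function.Injective fun a => g (s a) := fun a b hab =>
        by_contra fun h => hne a b h hab
      have := Nat.card_le_card_of_injective _ hinj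
      simp at this
    exact ⟨a, b, hab, j, hg _ _ (hj a) (hj b) he⟩

theorem Expressible.exSet {P : Pred A m (n + 1)} (hP : Expressible P) :
    Expressible (fun w v V => ∃ X : Finset ℕ, P w v (consSet X V)) := by
  obtain ⟨R, N, hR, h⟩ := hP.exists_relation
  have hrep := fun i => definable_isRep_of_covered (definable_covered hR i)
  choose Q hQ hQ' using fun i => hP.subst (D := fun w v V => IsRep (R w v V) i) (hrep i)
  -- `Q i` is meaningful only if representative `i` exists, hence the extra conjunct.
  refine (Expressible.exists_lt (fun i => (hrep i).exSet.expressible.and (hQ i)) N).congr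
    fun w v V => ?_
  constructor
  · rintro ⟨i, -, ⟨X, hX⟩, hi⟩
    exact ⟨X, (hQ' i w v V X hX fun X' hX' => IsRep.unique hX' hX).1 hi⟩
  · rintro ⟨X, hX⟩
    obtain ⟨i, hi, Z, hZ, hXZ⟩ := ((h w v V).2 X).exists_isRep
    exact ⟨i, hi, ⟨Z, hZ⟩, (hQ' i w v V Z hZ fun X' hX' => IsRep.unique hX' hZ).2
      (((h w v V).1 X Z hXZ).1 hX)⟩

theorem Expressible.exPos {P : Pred A (m + 1) n} (hP : Expressible P) :
    Expressible (fun w v V => ∃ x, P w (consPos x v) V) := by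
  obtain ⟨Q, hQ, h⟩ := hP.singleton
  have hs : Definable (A := A) (m := m) (n := n + 1)
      (fun _ _ V => ∃ x, ∀ y, y ∈ V 0 ↔ y = x) :=
    ((Definable.mem 0 0).iff (Definable.eq 0 1)).allPos.exPos
  refine (hs.expressible.and hQ).exSet.congr fun w v V => ?_
  constructor
  · rintro ⟨X, ⟨x, hx⟩, hX⟩
    have : (X : Set ℕ) = {x} := Set.ext hx
    rw [this, h] at hX
    exact ⟨x, hX⟩
  · rintro ⟨x, hx⟩
    refine ⟨{x}, ⟨x, fun y => by simp [consSet]⟩, ?_⟩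
    rw [Finset.coe_singleton, h]
    exact hx

/-- Sets related to the same representative agree on `P`, so P-sets are unbounded in size exactly
when some representative satisfying `P` has related sets of unbounded size. That unboundedness
already implies the representative exists. -/
theorem Expressible.unbounding {P : Pred A m (n + 1)} (hP : Expressible P) :
    Expressible (fun w v V => ∀ k : ℕ, ∃ X : Finset ℕ, P w v (consSet X V) ∧ k ≤ X.card) := by
  obtain ⟨R, N, hR, h⟩ := hP.exists_relation
  have hrep := fun i => definable_isRep_of_covered (definable_covered hR i)
  choose Q hQ hQ' using fun i => hP.subst (D := fun w v V => IsRep (R w v V) i) (hrep i)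
  have hclass : ∀ i, Definable (A := A) (m := m) (n := n + 1) (fun w v V =>
      ∃ Z : Finset ℕ, IsRep (R w v fun i => V i.succ) i Z ∧
        R w v (fun i => V i.succ) (V 0) Z) := fun i =>
    (((hrep i).rename id (Fin.cons 0 fun i => i.succ.succ)).and
      (hR.rename id (Fin.cons 1 (Fin.cons 0 fun i => i.succ.succ)))).exSet
  refine (Expressible.exists_lt (fun i => (hQ i).and (Expressible.unb (hclass i))) N).congr
    fun w v V => ?_
  constructor
  · rintro ⟨i, -, hi, hU⟩ k
    obtain ⟨X, ⟨Z, hZ, hXZ⟩, hk⟩ := hU k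
    exact ⟨X, ((h w v V).1 X Z hXZ).2
      ((hQ' i w v V Z hZ fun X' hX' => IsRep.unique hX' hZ).1 hi), hk⟩
  · intro hU
    by_contra! hne
    -- Otherwise each relevant piece has a size bound, and a P-set as large as the maximum of these
    -- bounds belongs to no piece.
    have hb : ∀ i, ∃ k, i < N → Q i w v V → ∀ X Z : Finset ℕ, IsRep (R w v V) i Z →
        R w v V X Z → X.card < k := by
      intro i
      by_cases hi : i < N ∧ Q i w v V
      · obtain ⟨k, hk⟩ := hne i hi.1 hi.2
        exact ⟨k, fun _ _ X Z hZ hXZ => hk X ⟨Z, hZ, hXZ⟩⟩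
      · exact ⟨0, fun h₁ h₂ => (hi ⟨h₁, h₂⟩).elim⟩
    choose k hk using hb
    obtain ⟨X, hX, hle⟩ := hU ((Finset.range N).sup k)
    obtain ⟨i, hi, Z, hZ, hXZ⟩ := ((h w v V).2 X).exists_isRep
    have hQi := (hQ' i w v V Z hZ fun X' hX' => IsRep.unique hX' hZ).2
      (((h w v V).1 X Z hXZ).1 hX)
    exact (hk i hi hQi X Z hZ hXZ).not_ge
      ((Finset.le_sup (Finset.mem_range.2 hi)).trans hle)

theorem Formula.expressible (φ : Formula A m n) : Expressible φ.Holds := by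
  induction φ with
  | letter a x => exact Definable.expressible ⟨.letter a x, trivial, fun _ _ _ => Iff.rfl⟩
  | eq x y => exact (Definable.eq x y).expressible
  | lt x y => exact (Definable.lt x y).expressible
  | mem x X => exact (Definable.mem x X).expressible
  | not φ ih => exact ih.not
  | and φ ψ ih₁ ih₂ => exact ih₁.and ih₂
  | exPos φ ih => exact ih.exPos
  | exSet φ ih => exact ih.exSet
  | unb φ ih => exact ih.unbounding

end Expressible

end WeakUnbounding

theorem mainTheorem7 {A : Type*} [Finite A] {m n : ℕ}
    (φ : WeakUnbounding.Formula A m n) :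
    ∃ ψ : WeakUnbounding.Formula A m n,
      WeakUnbounding.Formula.BoolComb
        {χ | ∃ θ : WeakUnbounding.Formula A m (n + 1),
          θ.UFree ∧ χ = WeakUnbounding.Formula.unb θ} ψ ∧
      WeakUnbounding.Formula.Equivalent φ ψ := by
  obtain ⟨ψ, hψ, h⟩ := φ.expressible
  exact ⟨ψ, hψ, fun w v V => (h w v V).symm⟩
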